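/- Let $f:\mathbb R^n\times\mathbb R^m\to\mathbb R^n$ be smooth and control-affine, $f(x,u)=f_0(x)+g(x)u$, and consider the system $\dot x=f(x,u)$. Let $T>0$, $\Theta=[0,T]$, let $x_r:\Theta\to\mathbb R^n$ be a smooth reference path, and put $r=dx_r/d\theta$. In the coordinates $(\theta,x_d)$, where $x=x_d+x_r(\theta)$, with inputs $v=(u_0,u)$, the system reads $$\dot\theta=u_0,\qquad \dot x_d=f(x_d+x_r(\theta),u)-r(\theta)\,u_0 .$$ Let $0<\underline{u}_0\le\overline{u}_0<\infty$ and let the inputs be restricted to a nonempty polytope $\mathcal V\subseteq[\underline u_0,\overline u_0]\times\mathbb R^m$. Let $I,G\subseteq\mathbb R^n$ and $S(\theta)\subseteq\mathbb R^n$ $(\theta\in\Theta)$ be the initial set, the goal set and the safe sets, all given as sets of deviations $x_d$, and let $S=\bigcup_{\theta\in\Theta}S(\theta)$. Let $\beta\in\mathbb R$ and let $V:\Theta\times\mathbb R^n\to\mathbb R$ be a control funnel function, that is, $V$ is smooth and (a) $V(0,x_d)<\beta$ for all $x_d\in I$; (b) $V(T,x_d)>\beta$ for all $x_d\notin\operatorname{int}(G)$;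 (c) $V(\theta,x_d)>\beta$ for all $\theta\in\Theta$ and $x_d\notin\operatorname{int}(S(\theta))$; (d) for all $\theta\in\Theta$ and $x_d\in S(\theta)$ with $V(\theta,x_d)=\beta$ there is $v=(u_0,u)\in\mathcal V$ with $\dot V(\theta,x_d,v)<0$, where $\dot V(\theta,x_d,v)=\partial_\theta V(\theta,x_d)\,u_0+\nabla_{x_d}V(\theta,x_d)\cdot\big(f(x_d+x_r(\theta),u)-r(\theta)u_0\big)$. Assume also that $V^{\le\beta}=\bigcup_{\theta\in\Theta}\{x_d : V(\theta,x_d)\le\beta\}$ is bounded. Then there are a smooth timing law $u_0(\theta,x_d)$ and a smooth feedback law $u(\theta,x_d)$ with $(u_0(\theta,x_d),u(\theta,x_d))\in\mathcal V$ everywhere and $\dot V(\theta,x_d,u_0(\theta,x_d),u(\theta,x_d))<0$ whenever $\theta\in\Theta$ and $V(\theta,x_d)=\beta$, such that for every $x_0\in I$ the closed loop with $\theta(0)=0$, $x_d(0)=x_0$ has a unique trajectory in $\Theta\times\mathbb R^n$, defined up to the time $t^*$ at which $\theta(t^*)=T$; this time satisfies $$\frac{T}{\overline u_0}\le t^*\le\frac{T}{\underline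 u_0},$$ the goal is reached, $x_d(t^*)\in G$, and $x_d(t)\in S(\theta(t))\subseteq S$ for all $0\le t\le t^*$. -/

import Mathlib

open Set
open scoped ContDiff

noncomputable section

namespace PathSegment

/-- `ℝⁿ`. -/
abbrev Vec (n : ℕ) : Type := EuclideanSpace ℝ (Fin n)

/-- The dynamics `ẋ = f(x, u)` are control-affine: `f(x, u) = f₀(x) + g(x) u`. -/
def IsControlAffine {n m : ℕ} (f : Vec n → Vec m → Vec n) : Prop :=
  ∃ (f₀ : Vec n → Vec n) (g : Vec n → Vec m →ₗ[ℝ] Vec n), ∀ x u, f x u = f₀ x + g x u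

/-- A (nonempty, possibly lower-dimensional) polytope: the convex hull of finitely many points. -/
def IsPolytope {E : Type*} [AddCommGroup E] [Module ℝ E] (P : Set E) : Prop :=
  ∃ F : Finset E, F.Nonempty ∧ P = convexHull ℝ (F : Set E)

/-- The parameter range `Θ = [0, T]` of the reference path. -/
def Theta (T : ℝ) : Set ℝ := Icc 0 T

/-- `Θ × ℝⁿ`, the domain of the coordinates `z = (θ, x_d)`. -/
def Dom (n : ℕ) (T : ℝ) : Set (ℝ × Vec n) := Theta T ×ˢ univ

/-- The tangent `r(θ) = dx_r/dθ` of the reference path (one-sided at the ends of `Θ`). -/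
def tangent {n : ℕ} (T : ℝ) (xr : ℝ → Vec n) (θ : ℝ) : Vec n := derivWithin xr (Theta T) θ

/-- The right-hand side of the deviation dynamics,
`ẋ_d = f(x_d + x_r(θ), u) - r(θ) u₀`, with input `v = (u₀, u)`. -/
def devField {n m : ℕ} (f : Vec n → Vec m → Vec n) (T : ℝ) (xr : ℝ → Vec n)
    (θ : ℝ) (x : Vec n) (v : ℝ × Vec m) : Vec n :=
  f (x + xr θ) v.2 - v.1 • tangent T xr θ

/-- `V̇(θ, x_d, v)`: the derivative of `V` at `(θ, x_d)` in the direction `(θ̇, ẋ_d)` given by the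
input `v = (u₀, u)`, where `θ̇ = u₀`. -/
def Vdot {n m : ℕ} (f : Vec n → Vec m → Vec n) (T : ℝ) (xr : ℝ → Vec n) (V : ℝ × Vec n → ℝ)
    (θ : ℝ) (x : Vec n) (v : ℝ × Vec m) : ℝ :=
  fderivWithin ℝ V (Dom n T) (θ, x) (v.1, devField f T xr θ x v)

/-- Control funnel functions at level `β` for the initial set `I`, the goal set `G` and the safe
sets `S θ` (all of them sets of deviations `x_d`), with inputs in `Vin`. -/
structure IsControlFunnel {n m : ℕ} (f : Vec n → Vec m → Vec n) (T : ℝ) (xr : ℝ → Vec n)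
    (Vin : Set (ℝ × Vec m)) (I G : Set (Vec n)) (S : ℝ → Set (Vec n))
    (V : ℝ × Vec n → ℝ) (β : ℝ) : Prop where
  smooth : ContDiffOn ℝ ∞ V (Dom n T)
  init : ∀ x ∈ I, V (0, x) < β
  goal : ∀ x ∉ interior G, β < V (T, x)
  safe : ∀ θ ∈ Theta T, ∀ x ∉ interior (S θ), β < V (θ, x)
  decrease : ∀ θ ∈ Theta T, ∀ x ∈ S θ, V (θ, x) = β → ∃ v ∈ Vin, Vdot f T xr V θ x v < 0

/-- `V^{≤β}`, the union over `θ ∈ Θ` of the sublevel sets of `V(θ, ·)`. -/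
def sublevel {n : ℕ} (T : ℝ) (V : ℝ × Vec n → ℝ) (β : ℝ) : Set (Vec n) :=
  ⋃ θ ∈ Theta T, {x | V (θ, x) ≤ β}

/-- `(θ, x_d)` is a solution on the time interval `[0, τ]` of the closed loop
`θ̇ = u₀(θ, x_d)`, `ẋ_d = f(x_d + x_r(θ), u(θ, x_d)) - r(θ) u₀(θ, x_d)` with `θ(0) = 0` and
`x_d(0) = x₀`, remaining in the range `θ ∈ Θ` in which the reference path is given. -/
structure IsTrajectory {n m : ℕ} (f : Vec n → Vec m → Vec n) (T : ℝ) (xr : ℝ → Vec n)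
    (u₀ : ℝ × Vec n → ℝ) (u : ℝ × Vec n → Vec m) (x₀ : Vec n)
    (τ : ℝ) (θ : ℝ → ℝ) (x : ℝ → Vec n) : Prop where
  init_theta : θ 0 = 0
  init_state : x 0 = x₀
  mem_Theta : ∀ t ∈ Icc 0 τ, θ t ∈ Theta T
  deriv_theta : ∀ t ∈ Icc 0 τ, HasDerivWithinAt θ (u₀ (θ t, x t)) (Icc 0 τ) t
  deriv_state : ∀ t ∈ Icc 0 τ,
    HasDerivWithinAt x (devField f T xr (θ t) (x t) (u₀ (θ t, x t), u (θ t, x t))) (Icc 0 τ) t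

end PathSegment

end

/-!
On the part `{V = β}` of the strip `Θ × ℝⁿ`, which is closed, the inputs of `Vin` that strictly
decrease `V` form a nonempty convex set, because `V̇` is affine in the input; and an input that
decreases `V` at one point does so at all nearby points of the strip. A smooth partition of unity
therefore glues locally constant choices into a smooth feedback with values in `Vin`
(`exists_smooth_feedback`).

Along the closed loop `V` can never climb to `β`: at the first time at which it did, its left
derivative would be nonnegative, while the feedback makes it negative
(`lt_of_hasDerivWithinAt_neg`, `lt_level_of_trajectory`). So trajectories issuing from `I` stay in
`{V < β}`, which lies over the interiors of the safe sets, and over that of the goal set at `θ = T`.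

Since `V^{≤β}` is bounded, `{V ≤ β}` is contained in a compact box `Θ × [-R, R]ⁿ`. The closed-loop
field is Lipschitz on the box, and composing it with the coordinatewise retraction onto the box
gives a bounded, globally Lipschitz field, whose solutions exist for all times
(`exists_solution_of_lipschitzWith_of_bounded`). Because `dθ/dt` takes values in `[ulo, uhi]`,
the solution reaches `θ = T` at a time between `T / uhi` and `T / ulo`; up to then it
stays in the box, so it solves the original equation. Uniqueness is Grönwall's inequality on the box, and no trajectory
survives longer, as `θ` would leave `Θ`.
-/

namespace PathSegment

open Filter Topology

/-! ### Calculus on a time interval -/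

/-- A barrier principle: a function starting below `β` whose derivative is negative whenever it
takes the value `β` stays below `β`. -/
theorem lt_of_hasDerivWithinAt_neg {φ : ℝ → ℝ} {τ β : ℝ} (hc : ContinuousOn φ (Icc 0 τ))
    (h0 : φ 0 < β)
    (hd : ∀ t ∈ Icc 0 τ, φ t = β → ∃ d < 0, HasDerivWithinAt φ d (Icc 0 τ) t) :
    ∀ t ∈ Icc 0 τ, φ t < β := by
  by_contra! ⟨t, ht, hβ⟩
  set A : Set ℝ := Icc 0 τ ∩ φ ⁻¹' Ici β with hA
  have hAc : IsCompact A :=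
    isCompact_Icc.of_isClosed_subset
      (hc.preimage_isClosed_of_isClosed isClosed_Icc isClosed_Ici) inter_subset_left
  obtain ⟨s, ⟨hs, hsβ⟩, hmin⟩ := hAc.exists_isLeast ⟨t, ht, hβ⟩
  have hlt : ∀ y ∈ Ioo 0 s, φ y < β := by
    intro y hy
    by_contra! h
    exact absurd (hmin ⟨⟨hy.1.le, hy.2.le.trans hs.2⟩, h⟩) (not_le.2 hy.2)
  have hs0 : 0 < s := by
    rcases hs.1.eq_or_lt with h | h
    · rw [← h] at hsβ
      exact absurd hsβ (not_le.2 h0)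
    · exact h
  have hsub : Ioo 0 s ⊆ Icc 0 τ := fun y hy => ⟨hy.1.le, hy.2.le.trans hs.2⟩
  have : (𝓝[Ioo 0 s] s).NeBot := right_nhdsWithin_Ioo_neBot hs0
  have heq : φ s = β := by
    refine le_antisymm ?_ hsβ
    exact le_of_tendsto ((hc s hs).mono hsub)
      (eventually_nhdsWithin_of_forall fun y hy => (hlt y hy).le)
  obtain ⟨d, hd0, hd⟩ := hd s hs heq
  -- The slopes of `φ` to the left of the first hitting time `s` are nonnegative.
  have hslope := hasDerivWithinAt_iff_tendsto_slope.1 (hd.mono hsub)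
  rw [sdiff_singleton_eq_self (by simp)] at hslope
  refine not_le.2 hd0 (ge_of_tendsto hslope (eventually_nhdsWithin_of_forall fun y hy => ?_))
  rw [slope_def_field]
  exact div_nonneg_of_nonpos (by linarith [hlt y hy]) (by linarith [hy.2])

theorem sub_mem_Icc_of_hasDerivWithinAt {φ φ' : ℝ → ℝ} {τ lo hi : ℝ}
    (hd : ∀ t ∈ Icc 0 τ, HasDerivWithinAt φ (φ' t) (Icc 0 τ) t)
    (hφ' : ∀ t ∈ Icc 0 τ, φ' t ∈ Icc lo hi) {s t : ℝ} (hs : s ∈ Icc 0 τ) (ht : t ∈ Icc 0 τ)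
    (hst : s ≤ t) : φ t - φ s ∈ Icc (lo * (t - s)) (hi * (t - s)) := by
  have hc : ContinuousOn φ (Icc 0 τ) := fun y hy => (hd y hy).continuousWithinAt
  have hd' : ∀ y ∈ interior (Icc 0 τ), HasDerivAt φ (φ' y) y := fun y hy =>
    (hd y (interior_subset hy)).hasDerivAt (mem_interior_iff_mem_nhds.1 hy)
  have hdiff : DifferentiableOn ℝ φ (interior (Icc 0 τ)) := fun y hy =>
    (hd' y hy).differentiableAt.differentiableWithinAt
  constructor
  · refine (convex_Icc 0 τ).mul_sub_le_image_sub_of_le_deriv hc hdiff (fun y hy => ?_) s hs t ht hst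
    rw [(hd' y hy).deriv]
    exact (hφ' y (interior_subset hy)).1
  · refine (convex_Icc 0 τ).image_sub_le_mul_sub_of_deriv_le hc hdiff (fun y hy => ?_) s hs t ht hst
    rw [(hd' y hy).deriv]
    exact (hφ' y (interior_subset hy)).2

theorem exists_solution_of_lipschitzWith_of_bounded {E : Type*} [NormedAddCommGroup E]
    [NormedSpace ℝ E] [CompleteSpace E] {F : E → E} {K L : NNReal} (hF : LipschitzWith K F)
    (hL : ∀ z, ‖F z‖ ≤ L) {τ : ℝ} (hτ : 0 ≤ τ) (z₀ : E) :
    ∃ z : ℝ → E, z 0 = z₀ ∧ ∀ t ∈ Icc 0 τ, HasDerivWithinAt z (F (z t)) (Icc 0 τ) t := by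
  have hPL : IsPicardLindelof (fun _ => F) (⟨0, left_mem_Icc.2 hτ⟩ : Icc (0 : ℝ) τ) z₀
      (L * τ.toNNReal) 0 L K :=
    { lipschitzOnWith := fun _ _ => hF.lipschitzOnWith
      continuousOn := fun _ _ => continuousOn_const
      norm_le := fun _ _ z _ => hL z
      mul_max_le := by simp [hτ] }
  exact hPL.exists_eq_forall_mem_Icc_hasDerivWithinAt₀

/-! ### The box and its retraction -/

/-- The compact box `Θ × [-R, R]ⁿ`. A box, rather than a cylinder over a Euclidean ball, is used
because it has an explicit Lipschitz retraction, the coordinatewise one. -/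
def box (n : ℕ) (T R : ℝ) : Set (ℝ × Vec n) :=
  Theta T ×ˢ {x : Vec n | ∀ i, x i ∈ Icc (-R) R}

theorem box_subset_Dom (n : ℕ) (T R : ℝ) : box n T R ⊆ Dom n T :=
  prod_mono_right (subset_univ _)

theorem convex_box (n : ℕ) (T R : ℝ) : Convex ℝ (box n T R) := by
  refine (convex_Icc 0 T).prod fun x hx y hy a b ha hb hab i => ?_
  simpa using convex_Icc (-R) R (hx i) (hy i) ha hb hab

theorem isCompact_box (n : ℕ) (T R : ℝ) : IsCompact (box n T R) := by
  refine isCompact_Icc.prod ?_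
  have h : IsCompact (univ.pi fun _ : Fin n => Icc (-R) R) :=
    isCompact_univ_pi fun _ => isCompact_Icc
  convert h.image (PiLp.continuous_toLp 2 fun _ : Fin n => ℝ) using 1
  ext x
  constructor
  · exact fun hx => ⟨WithLp.ofLp x, fun i _ => hx i, rfl⟩
  · rintro ⟨y, hy, rfl⟩ i
    exact hy i (mem_univ i)

theorem exists_lipschitzWith_retraction_box (n : ℕ) {T R : ℝ} (hT : 0 ≤ T) (hR : 0 ≤ R) :
    ∃ (K : NNReal) (P : ℝ × Vec n → ℝ × Vec n), LipschitzWith K P ∧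
      (∀ z, P z ∈ box n T R) ∧ ∀ z ∈ box n T R, P z = z := by
  have hR' : -R ≤ R := by linarith
  have h1 : LipschitzWith 1 fun s : ℝ => (projIcc 0 T hT s : ℝ) :=
    LipschitzWith.projIcc hT
  have h2 : LipschitzWith 1 fun (w : Fin n → ℝ) (i : Fin n) => (projIcc (-R) R hR' (w i) : ℝ) :=
    LipschitzWith.of_dist_le_mul fun v w => by
      rw [NNReal.coe_one, one_mul, dist_pi_le_iff dist_nonneg]
      exact fun i => (by simpa using (LipschitzWith.projIcc hR').dist_le_mul (v i) (w i) :
        dist (projIcc (-R) R hR' (v i)) (projIcc (-R) R hR' (w i)) ≤ dist (v i) (w i)).trans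
          (dist_le_pi_dist v w i)
  have h3 := (PiLp.lipschitzWith_toLp 2 (fun _ : Fin n => ℝ)).comp
    (h2.comp (PiLp.lipschitzWith_ofLp 2 (fun _ : Fin n => ℝ)))
  refine ⟨_, _, (h1.comp LipschitzWith.prod_fst).prodMk (h3.comp LipschitzWith.prod_snd),
    fun z => ⟨Subtype.coe_prop _, fun i => ?_⟩, fun z hz => Prod.ext ?_ ?_⟩
  · exact Subtype.coe_prop (projIcc (-R) R hR' (z.2 i))
  · exact congrArg Subtype.val (projIcc_of_mem hT hz.1)
  · ext i
    exact congrArg Subtype.val (projIcc_of_mem hR' (hz.2 i))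

/-! ### Regularity on the strip -/

section Regularity

variable {n m : ℕ} {f : Vec n → Vec m → Vec n} {T : ℝ} {xr : ℝ → Vec n}

theorem uniqueDiffOn_Dom (n : ℕ) (hT : 0 < T) : UniqueDiffOn ℝ (Dom n T) :=
  (uniqueDiffOn_Icc hT).prod uniqueDiffOn_univ

theorem isClosed_Dom (n : ℕ) (T : ℝ) : IsClosed (Dom n T) :=
  isClosed_Icc.prod isClosed_univ

theorem contDiffOn_devField (hf : ContDiff ℝ ∞ fun p : Vec n × Vec m => f p.1 p.2)
    (hT : 0 < T) (hxr : ContDiffOn ℝ ∞ xr (Theta T)) {v : ℝ × Vec n → ℝ × Vec m}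
    (hv : ContDiff ℝ ∞ v) :
    ContDiffOn ℝ ∞ (fun z => devField f T xr z.1 z.2 (v z)) (Dom n T) := by
  have hfst : MapsTo Prod.fst (Dom n T) (Theta T) := fun z hz => hz.1
  have hr : ContDiffOn ℝ ∞ (tangent T xr) (Theta T) :=
    hxr.derivWithin (uniqueDiffOn_Icc hT) le_rfl
  have h1 : ContDiffOn ℝ ∞ (fun z : ℝ × Vec n => (z.2 + xr z.1, (v z).2)) (Dom n T) :=
    (contDiff_snd.contDiffOn.add (hxr.comp contDiff_fst.contDiffOn hfst)).prodMk
      hv.snd.contDiffOn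
  exact (hf.comp_contDiffOn h1).sub
    (hv.fst.contDiffOn.smul (hr.comp contDiff_fst.contDiffOn hfst))

theorem continuousOn_Vdot (hf : ContDiff ℝ ∞ fun p : Vec n × Vec m => f p.1 p.2)
    (hT : 0 < T) (hxr : ContDiffOn ℝ ∞ xr (Theta T)) {V : ℝ × Vec n → ℝ}
    (hV : ContDiffOn ℝ ∞ V (Dom n T)) (v : ℝ × Vec m) :
    ContinuousOn (fun z : ℝ × Vec n => Vdot f T xr V z.1 z.2 v) (Dom n T) :=
  (hV.continuousOn_fderivWithin (uniqueDiffOn_Dom n hT) (by simp)).clm_apply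
    (continuousOn_const.prodMk (contDiffOn_devField hf hT hxr contDiff_const).continuousOn)

theorem convex_setOf_Vdot_neg (hf : IsControlAffine f) (T : ℝ) (xr : ℝ → Vec n)
    (V : ℝ × Vec n → ℝ) (θ : ℝ) (x : Vec n) :
    Convex ℝ {v : ℝ × Vec m | Vdot f T xr V θ x v < 0} := by
  obtain ⟨f₀, g, hfg⟩ := hf
  intro v hv w hw a b ha hb hab
  have key : Vdot f T xr V θ x (a • v + b • w) =
      a * Vdot f T xr V θ x v + b * Vdot f T xr V θ x w := by
    simp only [Vdot, ← smul_eq_mul, ← map_smul, ← map_add]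
    congr 1
    refine Prod.ext (by simp) ?_
    simp only [devField, hfg, Prod.snd_add, Prod.smul_snd, Prod.fst_add, Prod.smul_fst, map_add,
      map_smul, smul_eq_mul, Prod.smul_mk, Prod.mk_add_mk]
    have h : f₀ (x + xr θ) = a • f₀ (x + xr θ) + b • f₀ (x + xr θ) := by
      rw [← add_smul, hab, one_smul]
    nth_rewrite 1 [h]
    module
  have hv' : Vdot f T xr V θ x v < 0 := hv
  have hw' : Vdot f T xr V θ x w < 0 := hw
  show _ < (0 : ℝ)
  rw [key]
  rcases ha.eq_or_lt with rfl | ha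
  · have : b = 1 := by linarith
    subst this
    linarith
  · nlinarith [mul_neg_of_pos_of_neg ha hv', mul_nonneg hb (neg_nonneg.2 hw'.le)]

end Regularity

/-! ### The smooth feedback -/

section Feedback

variable {n m : ℕ} {f : Vec n → Vec m → Vec n} {T : ℝ} {xr : ℝ → Vec n}
  {Vin : Set (ℝ × Vec m)} {I G : Set (Vec n)} {S : ℝ → Set (Vec n)}
  {V : ℝ × Vec n → ℝ} {β : ℝ}

theorem IsPolytope.convex {E : Type*} [AddCommGroup E] [Module ℝ E] {P : Set E}
    (hP : IsPolytope P) : Convex ℝ P := by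
  obtain ⟨F, -, rfl⟩ := hP
  exact convex_convexHull ℝ _

theorem IsPolytope.nonempty {E : Type*} [AddCommGroup E] [Module ℝ E] {P : Set E}
    (hP : IsPolytope P) : P.Nonempty := by
  obtain ⟨F, hF, rfl⟩ := hP
  exact convexHull_nonempty_iff.2 hF

theorem IsControlFunnel.mem_interior_safe (hV : IsControlFunnel f T xr Vin I G S V β)
    {z : ℝ × Vec n} (hz : z ∈ Dom n T) (hle : V z ≤ β) : z.2 ∈ interior (S z.1) := by
  by_contra h
  exact absurd (hV.safe z.1 hz.1 z.2 h) (not_lt.2 hle)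

/-- A smooth selection, by a partition of unity, of inputs that decrease `V` on `{V = β}`. -/
theorem exists_smooth_feedback (hf : ContDiff ℝ ∞ fun p : Vec n × Vec m => f p.1 p.2)
    (hf_affine : IsControlAffine f) (hT : 0 < T) (hxr : ContDiffOn ℝ ∞ xr (Theta T))
    (hVin : IsPolytope Vin) (hV : IsControlFunnel f T xr Vin I G S V β) :
    ∃ v : ℝ × Vec n → ℝ × Vec m, ContDiff ℝ ∞ v ∧ (∀ z, v z ∈ Vin) ∧
      ∀ z ∈ Dom n T, V z = β → Vdot f T xr V z.1 z.2 (v z) < 0 := by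
  have hK : IsClosed (Dom n T ∩ V ⁻¹' {β}) :=
    hV.smooth.continuousOn.preimage_isClosed_of_isClosed (isClosed_Dom n T) isClosed_singleton
  let A : ℝ × Vec n → Set (ℝ × Vec m) := fun z =>
    {v | v ∈ Vin ∧ (z ∈ Dom n T ∩ V ⁻¹' {β} → Vdot f T xr V z.1 z.2 v < 0)}
  have hconv : ∀ z, Convex ℝ (A z) := fun z v hv w hw a b ha hb hab =>
    ⟨hVin.convex hv.1 hw.1 ha hb hab, fun hz =>
      convex_setOf_Vdot_neg hf_affine T xr V z.1 z.2 (hv.2 hz) (hw.2 hz) ha hb hab⟩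
  have hloc : ∀ z, ∃ v, ∀ᶠ y in 𝓝 z, v ∈ A y := by
    intro z
    by_cases hz : z ∈ Dom n T ∩ V ⁻¹' {β}
    · obtain ⟨v, hv, hneg⟩ := hV.decrease z.1 hz.1.1 z.2
        (interior_subset (hV.mem_interior_safe hz.1 hz.2.le)) hz.2
      refine ⟨v, ?_⟩
      have hev := (continuousOn_Vdot hf hT hxr hV.smooth v z hz.1).eventually_lt_const hneg
      filter_upwards [eventually_nhdsWithin_iff.1 hev] with y hy
      exact ⟨hv, fun hyK => hy hyK.1⟩
    · obtain ⟨v, hv⟩ := hVin.nonempty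
      refine ⟨v, ?_⟩
      filter_upwards [hK.isOpen_compl.mem_nhds hz] with y hy
      exact ⟨hv, fun hyK => absurd hyK hy⟩
  obtain ⟨v, hv⟩ := exists_contMDiffMap_forall_mem_convex_of_local_const (n := ⊤)
    (modelWithCornersSelf ℝ (ℝ × Vec n)) hconv hloc
  exact ⟨v, v.contMDiff.contDiff, fun z => (hv z).1, fun z hz hβ => (hv z).2 ⟨hz, hβ⟩⟩

end Feedback

/-! ### The closed loop -/

section ClosedLoop

variable {n m : ℕ} {f : Vec n → Vec m → Vec n} {T : ℝ} {xr : ℝ → Vec n}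
  {Vin : Set (ℝ × Vec m)} {I G : Set (Vec n)} {S : ℝ → Set (Vec n)}
  {V : ℝ × Vec n → ℝ} {β : ℝ} {v : ℝ × Vec n → ℝ × Vec m}

/-- The closed-loop vector field in the coordinates `z = (θ, x_d)` under the feedback `v`. -/
noncomputable def closedLoop (f : Vec n → Vec m → Vec n) (T : ℝ) (xr : ℝ → Vec n)
    (v : ℝ × Vec n → ℝ × Vec m) (z : ℝ × Vec n) : ℝ × Vec n :=
  ((v z).1, devField f T xr z.1 z.2 (v z))

theorem contDiffOn_closedLoop (hf : ContDiff ℝ ∞ fun p : Vec n × Vec m => f p.1 p.2)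
    (hT : 0 < T) (hxr : ContDiffOn ℝ ∞ xr (Theta T)) (hv : ContDiff ℝ ∞ v) :
    ContDiffOn ℝ ∞ (closedLoop f T xr v) (Dom n T) :=
  hv.fst.contDiffOn.prodMk (contDiffOn_devField hf hT hxr hv)

theorem IsTrajectory.hasDerivWithinAt {x₀ : Vec n} {τ : ℝ} {θ : ℝ → ℝ} {x : ℝ → Vec n}
    (h : IsTrajectory f T xr (fun z => (v z).1) (fun z => (v z).2) x₀ τ θ x) {t : ℝ}
    (ht : t ∈ Icc 0 τ) :
    HasDerivWithinAt (fun s => (θ s, x s)) (closedLoop f T xr v (θ t, x t)) (Icc 0 τ) t :=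
  (h.deriv_theta t ht).prodMk (h.deriv_state t ht)

/-- The sublevel set `{V < β}` is forward invariant. The equation is only required to hold at the
times at which the curve is on the boundary `{V = β}`. -/
theorem lt_level_of_trajectory (hV : ContDiffOn ℝ ∞ V (Dom n T))
    (hdec : ∀ z ∈ Dom n T, V z = β → Vdot f T xr V z.1 z.2 (v z) < 0)
    {z : ℝ → ℝ × Vec n} {τ : ℝ} (hz : ContinuousOn z (Icc 0 τ)) (h0 : V (z 0) < β)
    (hDom : MapsTo z (Icc 0 τ) (Dom n T))
    (hd : ∀ t ∈ Icc 0 τ, V (z t) = β →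
      HasDerivWithinAt z (closedLoop f T xr v (z t)) (Icc 0 τ) t) :
    ∀ t ∈ Icc 0 τ, V (z t) < β := by
  refine lt_of_hasDerivWithinAt_neg (φ := V ∘ z) (hV.continuousOn.comp hz hDom) h0
    fun t ht hβ => ⟨_, hdec (z t) (hDom ht) hβ, ?_⟩
  exact ((hV.differentiableOn (by simp) (z t) (hDom ht)).hasFDerivWithinAt).comp_hasDerivWithinAt
    t (hd t ht hβ) hDom

theorem exists_sublevel_subset_box (hbdd : Bornology.IsBounded (sublevel T V β)) :
    ∃ R, 0 ≤ R ∧ ∀ z ∈ Dom n T, V z ≤ β → z ∈ box n T R := by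
  obtain ⟨R, hR⟩ := hbdd.exists_norm_le
  refine ⟨max R 0, le_max_right _ _, fun z hz hle => ⟨hz.1, fun i => abs_le.1 ?_⟩⟩
  exact ((PiLp.norm_apply_le z.2 i).trans (hR z.2 (mem_biUnion hz.1 hle))).trans (le_max_left _ _)

/-- Solving the equation with the field composed with a retraction onto the box and stopping at
`θ = T` yields a trajectory of the closed loop in `{V < β}`. -/
theorem exists_trajectory (hf : ContDiff ℝ ∞ fun p : Vec n × Vec m => f p.1 p.2)
    (hT : 0 < T) (hxr : ContDiffOn ℝ ∞ xr (Theta T)) {ulo uhi : ℝ} (hulo : 0 < ulo)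
    (hV : ContDiffOn ℝ ∞ V (Dom n T)) (hbdd : Bornology.IsBounded (sublevel T V β))
    (hv : ContDiff ℝ ∞ v) (hsat : ∀ z, (v z).1 ∈ Icc ulo uhi)
    (hdec : ∀ z ∈ Dom n T, V z = β → Vdot f T xr V z.1 z.2 (v z) < 0)
    {x₀ : Vec n} (h0 : V (0, x₀) < β) :
    ∃ (τ : ℝ) (θ : ℝ → ℝ) (x : ℝ → Vec n), T / uhi ≤ τ ∧ τ ≤ T / ulo ∧
      IsTrajectory f T xr (fun z => (v z).1) (fun z => (v z).2) x₀ τ θ x ∧ θ τ = T ∧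
      ∀ t ∈ Icc 0 τ, V (θ t, x t) < β := by
  obtain ⟨R, hR, hbox⟩ := exists_sublevel_subset_box hbdd
  obtain ⟨K, P, hP, hPmem, hPid⟩ := exists_lipschitzWith_retraction_box n hT.le hR
  have hF := (contDiffOn_closedLoop hf hT hxr hv).mono (box_subset_Dom n T R)
  obtain ⟨C, hC⟩ := hF.exists_lipschitzOnWith (by simp) (convex_box n T R) (isCompact_box n T R)
  obtain ⟨L, hL⟩ := (isCompact_box n T R).exists_bound_of_continuousOn hF.continuousOn
  have hτ : 0 ≤ T / ulo := by positivity
  have hLip : LipschitzWith (C * K) (closedLoop f T xr v ∘ P) :=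
    lipschitzOnWith_univ.1 (hC.comp hP.lipschitzOnWith fun z _ => hPmem z)
  obtain ⟨z, hz0, hz⟩ := exists_solution_of_lipschitzWith_of_bounded (L := L.toNNReal) hLip
    (fun z => (hL _ (hPmem z)).trans (Real.le_coe_toNNReal L)) hτ (0, x₀)
  have hθ : ∀ t ∈ Icc 0 (T / ulo),
      HasDerivWithinAt (fun s => (z s).1) (v (P (z t))).1 (Icc 0 (T / ulo)) t :=
    fun t ht => (hz t ht).fst
  have hθ0 : (z 0).1 = 0 := by rw [hz0]
  have hrate : ∀ s ∈ Icc 0 (T / ulo), ∀ t ∈ Icc 0 (T / ulo), s ≤ t →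
      (z t).1 - (z s).1 ∈ Icc (ulo * (t - s)) (uhi * (t - s)) := fun s hs t ht hst =>
    sub_mem_Icc_of_hasDerivWithinAt hθ (fun t _ => hsat (P (z t))) hs ht hst
  have hend : T ≤ (z (T / ulo)).1 := by
    have h := (hrate 0 (left_mem_Icc.2 hτ) _ (right_mem_Icc.2 hτ) hτ).1
    rwa [sub_zero, mul_div_cancel₀ _ hulo.ne', hθ0, sub_zero] at h
  obtain ⟨τ, hτmem, hτT⟩ := intermediate_value_Icc hτ
    (fun t ht => (hθ t ht).continuousWithinAt) ⟨hθ0.le.trans hT.le, hend⟩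
  have hsub : Icc 0 τ ⊆ Icc 0 (T / ulo) := Icc_subset_Icc_right hτmem.2
  have hmono : ∀ s ∈ Icc 0 (T / ulo), ∀ t ∈ Icc 0 (T / ulo), s ≤ t → (z s).1 ≤ (z t).1 :=
    fun s hs t ht hst => sub_nonneg.1
      ((mul_nonneg hulo.le (sub_nonneg.2 hst)).trans (hrate s hs t ht hst).1)
  have hΘ : ∀ t ∈ Icc 0 τ, (z t).1 ∈ Theta T := fun t ht =>
    ⟨hθ0.symm.le.trans (hmono 0 (left_mem_Icc.2 hτ) t (hsub ht) ht.1),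
      (hmono t (hsub ht) τ hτmem ht.2).trans hτT.le⟩
  have hderiv : ∀ t ∈ Icc 0 τ, V (z t) ≤ β →
      HasDerivWithinAt z (closedLoop f T xr v (z t)) (Icc 0 τ) t := by
    intro t ht hle
    have h := (hz t (hsub ht)).mono hsub
    rwa [Function.comp_apply, hPid _ (hbox _ ⟨hΘ t ht, mem_univ _⟩ hle)] at h
  have hlt : ∀ t ∈ Icc 0 τ, V (z t) < β :=
    lt_level_of_trajectory hV hdec
      (fun t ht => ((hz t (hsub ht)).mono hsub).continuousWithinAt) (by rwa [hz0])
      (fun t ht => ⟨hΘ t ht, mem_univ _⟩) fun t ht h => hderiv t ht h.le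
  have huhi : 0 < uhi := hulo.trans_le ((hsat (z 0)).1.trans (hsat (z 0)).2)
  refine ⟨τ, fun t => (z t).1, fun t => (z t).2, ?_, hτmem.2, ?_, hτT, hlt⟩
  · have h := (hrate 0 (left_mem_Icc.2 hτ) τ hτmem hτmem.1).2
    rw [hθ0, sub_zero, sub_zero] at h
    rw [div_le_iff₀' huhi]
    exact hτT.symm.le.trans h
  · exact
      { init_theta := hθ0
        init_state := by rw [hz0]
        mem_Theta := hΘ
        deriv_theta := fun t ht => (hderiv t ht (hlt t ht).le).fst
        deriv_state := fun t ht => (hderiv t ht (hlt t ht).le).snd }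

theorem IsTrajectory.lt_level (hV : ContDiffOn ℝ ∞ V (Dom n T))
    (hdec : ∀ z ∈ Dom n T, V z = β → Vdot f T xr V z.1 z.2 (v z) < 0)
    {x₀ : Vec n} (h0 : V (0, x₀) < β) {τ : ℝ} {θ : ℝ → ℝ} {x : ℝ → Vec n}
    (h : IsTrajectory f T xr (fun z => (v z).1) (fun z => (v z).2) x₀ τ θ x) :
    ∀ t ∈ Icc 0 τ, V (θ t, x t) < β :=
  lt_level_of_trajectory (z := fun t => (θ t, x t)) hV hdec
    (fun _ ht => (h.hasDerivWithinAt ht).continuousWithinAt) (by rwa [h.init_theta, h.init_state])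
    (fun t ht => ⟨h.mem_Theta t ht, mem_univ _⟩) fun _ ht _ => h.hasDerivWithinAt ht

theorem IsTrajectory.eqOn_Icc (hf : ContDiff ℝ ∞ fun p : Vec n × Vec m => f p.1 p.2)
    (hT : 0 < T) (hxr : ContDiffOn ℝ ∞ xr (Theta T)) (hV : ContDiffOn ℝ ∞ V (Dom n T))
    (hbdd : Bornology.IsBounded (sublevel T V β)) (hv : ContDiff ℝ ∞ v)
    (hdec : ∀ z ∈ Dom n T, V z = β → Vdot f T xr V z.1 z.2 (v z) < 0)
    {x₀ : Vec n} (h0 : V (0, x₀) < β) {τ τ' s : ℝ} {θ θ' : ℝ → ℝ} {x x' : ℝ → Vec n}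
    (h : IsTrajectory f T xr (fun z => (v z).1) (fun z => (v z).2) x₀ τ θ x)
    (h' : IsTrajectory f T xr (fun z => (v z).1) (fun z => (v z).2) x₀ τ' θ' x')
    (hs : s ≤ τ) (hs' : s ≤ τ') :
    EqOn (fun t => (θ t, x t)) (fun t => (θ' t, x' t)) (Icc 0 s) := by
  obtain ⟨R, -, hbox⟩ := exists_sublevel_subset_box hbdd
  obtain ⟨C, hC⟩ := ((contDiffOn_closedLoop hf hT hxr hv).mono
    (box_subset_Dom n T R)).exists_lipschitzOnWith (by simp) (convex_box n T R) (isCompact_box n T R)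
  have aux : ∀ {σ : ℝ} {η : ℝ → ℝ} {y : ℝ → Vec n},
      IsTrajectory f T xr (fun z => (v z).1) (fun z => (v z).2) x₀ σ η y → s ≤ σ →
      ContinuousOn (fun t => (η t, y t)) (Icc 0 s) ∧
      (∀ t ∈ Ico 0 s,
        HasDerivWithinAt (fun t => (η t, y t)) (closedLoop f T xr v (η t, y t)) (Ici t) t) ∧
      ∀ t ∈ Ico 0 s, (η t, y t) ∈ box n T R := by
    intro σ η y hy hsσ
    have hsub : Icc 0 s ⊆ Icc 0 σ := Icc_subset_Icc_right hsσ
    refine ⟨fun t ht => (hy.hasDerivWithinAt (hsub ht)).continuousWithinAt.mono hsub,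
      fun t ht => ?_, fun t ht => ?_⟩
    · exact (hy.hasDerivWithinAt (hsub (Ico_subset_Icc_self ht))).mono_of_mem_nhdsWithin
        (mem_of_superset (Icc_mem_nhdsGE_of_mem ht) hsub)
    · have ht' := hsub (Ico_subset_Icc_self ht)
      exact hbox _ ⟨hy.mem_Theta t ht', mem_univ _⟩ (hy.lt_level hV hdec h0 t ht').le
  obtain ⟨hc, hd, hm⟩ := aux h hs
  obtain ⟨hc', hd', hm'⟩ := aux h' hs'
  exact ODE_solution_unique_of_mem_Icc_right (v := fun _ => closedLoop f T xr v)
    (s := fun _ => box n T R) (fun _ _ => hC) hc hd hm hc' hd' hm'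
    (by simp [h.init_theta, h.init_state, h'.init_theta, h'.init_state])

end ClosedLoop

end PathSegment

theorem theorem2 {n m : ℕ}
    (f : PathSegment.Vec n → PathSegment.Vec m → PathSegment.Vec n)
    (hf : ContDiff ℝ ∞ (fun p : PathSegment.Vec n × PathSegment.Vec m => f p.1 p.2))
    (hf_affine : PathSegment.IsControlAffine f)
    (T : ℝ) (hT : 0 < T)
    (xr : ℝ → PathSegment.Vec n) (hxr : ContDiffOn ℝ ∞ xr (PathSegment.Theta T))
    (ulo uhi : ℝ) (hulo : 0 < ulo)
    (Vin : Set (ℝ × PathSegment.Vec m)) (hVin : PathSegment.IsPolytope Vin)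
    (hVin_sat : ∀ v ∈ Vin, v.1 ∈ Icc ulo uhi)
    (I G : Set (PathSegment.Vec n)) (S : ℝ → Set (PathSegment.Vec n))
    (V : ℝ × PathSegment.Vec n → ℝ) (β : ℝ)
    (hV : PathSegment.IsControlFunnel f T xr Vin I G S V β)
    (hbdd : Bornology.IsBounded (PathSegment.sublevel T V β)) :
    ∃ (u₀ : ℝ × PathSegment.Vec n → ℝ) (u : ℝ × PathSegment.Vec n → PathSegment.Vec m),
      ContDiff ℝ ∞ u₀ ∧ ContDiff ℝ ∞ u ∧
      -- input saturation
      (∀ z, (u₀ z, u z) ∈ Vin) ∧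
      -- the laws decrease `V` on the boundary of the funnel
      (∀ θ ∈ PathSegment.Theta T, ∀ x, V (θ, x) = β →
        PathSegment.Vdot f T xr V θ x (u₀ (θ, x), u (θ, x)) < 0) ∧
      ∀ x₀ ∈ I, ∃ (tstar : ℝ) (θ : ℝ → ℝ) (x : ℝ → PathSegment.Vec n),
        T / uhi ≤ tstar ∧ tstar ≤ T / ulo ∧
        PathSegment.IsTrajectory f T xr u₀ u x₀ tstar θ x ∧
        θ tstar = T ∧ x tstar ∈ G ∧
        (∀ t ∈ Icc 0 tstar, x t ∈ S (θ t)) ∧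
        -- this is the only trajectory of the closed loop from `x₀`
        (∀ (τ : ℝ) (θ' : ℝ → ℝ) (x' : ℝ → PathSegment.Vec n), 0 ≤ τ →
          PathSegment.IsTrajectory f T xr u₀ u x₀ τ θ' x' →
          τ ≤ tstar ∧ ∀ t ∈ Icc 0 τ, θ' t = θ t ∧ x' t = x t) := by
  obtain ⟨v, hv, hvin, hdec⟩ :=
    PathSegment.exists_smooth_feedback hf hf_affine hT hxr hVin hV
  have hsat : ∀ z, (v z).1 ∈ Icc ulo uhi := fun z => hVin_sat _ (hvin z)
  refine ⟨fun z => (v z).1, fun z => (v z).2, hv.fst, hv.snd, hvin,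
    fun θ hθ x hx => hdec (θ, x) ⟨hθ, mem_univ _⟩ hx, fun x₀ hx₀ => ?_⟩
  have h0 := hV.init x₀ hx₀
  obtain ⟨τ, θ, x, hlo, hhi, htraj, hend, hlt⟩ :=
    PathSegment.exists_trajectory hf hT hxr hulo hV.smooth hbdd hv hsat hdec h0
  have hτ : 0 ≤ τ :=
    (div_nonneg hT.le (hulo.le.trans ((hsat 0).1.trans (hsat 0).2))).trans hlo
  have hτmem : τ ∈ Icc 0 τ := right_mem_Icc.2 hτ
  refine ⟨τ, θ, x, hlo, hhi, htraj, hend, ?_, fun t ht => ?_, fun σ θ' x' hσ h' => ?_⟩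
  · by_contra hG
    have h := hV.goal (x τ) fun hint => hG (interior_subset hint)
    rw [← hend] at h
    exact absurd h (hlt τ hτmem).not_gt
  · exact interior_subset
      (hV.mem_interior_safe (z := (θ t, x t)) ⟨htraj.mem_Theta t ht, mem_univ _⟩ (hlt t ht).le)
  · have heq : ∀ s, s ≤ σ → s ≤ τ → ∀ t ∈ Icc 0 s, θ' t = θ t ∧ x' t = x t :=
      fun s hsσ hsτ t ht => Prod.mk.inj
        (h'.eqOn_Icc hf hT hxr hV.smooth hbdd hv hdec h0 htraj hsσ hsτ ht)
    have hle : σ ≤ τ := by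
      by_contra! hlt'
      -- `θ'` equals `T` at time `τ` and keeps increasing, so it leaves `Θ` at once.
      have h1 := (PathSegment.sub_mem_Icc_of_hasDerivWithinAt h'.deriv_theta
        (fun t _ => hsat (θ' t, x' t)) ⟨hτ, hlt'.le⟩ (right_mem_Icc.2 hσ) hlt'.le).1
      rw [(heq τ hlt'.le le_rfl τ hτmem).1, hend] at h1
      have h2 := (h'.mem_Theta σ (right_mem_Icc.2 hσ)).2
      have h3 := mul_pos hulo (sub_pos.2 hlt')
      linarith
    exact ⟨hle, heq σ le_rfl hle⟩
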